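/- Let $a,b,c\in\mathbb R\cup\{\infty\}$ and $d\in\mathbb R$ with $d<0$ and $d\le\min(2a,2b,2c)$. Write $(a_1,a_2,a_3)=(a,b,c)$ and let $f(x)=\min(2x_1,2x_2,2x_3,x_1+x_2+x_3,a+x_1,b+x_2,c+x_3,d)$ for $x\in\mathbb R^3$. Let $Sk\subset\mathbb R^3$ be the set of all $x$ at which the minimum $f(x)$ is attained by at least two of the eight listed terms and $x_1+x_2+x_3=f(x)$; equivalently, $x_1+x_2+x_3=\min(2x_1,2x_2,2x_3,a+x_1,b+x_2,c+x_3,d)$. For $i=1,2,3$ let $\mathcal C(X_i^2)=\{x\in Sk : x_1+x_2+x_3=2x_i\}$ (the quadratic cells). For $\{i,j,k\}=\{1,2,3\}$ put $f_i(x)=\min(2x_j,2x_k,a_j+x_j,a_k+x_k,d)$, and let $s_i:Sk\to Sk$ be the involution that replaces the coordinate $x_i$ by $f_i(x)-x_i$ and keeps the other two. Let $\Gamma=\langle s_1,s_2,s_3\rangle$ be the group of permutations of $Sk$ that they generate. Let $D_i=\{x\in Sk : 2x_i<f_i(x)\}$, which is the open half of $Sk$, bounded by the fixed set of $s_i$,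 that contains the interior of $\mathcal C(X_i^2)$. With closures and boundaries taken in $Sk$, let $$D_0=\Bigl(Sk\setminus\bigcup_{i=1}^3\overline{D}_i\Bigr)\cup\bigcup_{i=1}^3\Bigl(\partial D_i\setminus\bigcup_{j\ne i}\overline{D}_j\Bigr)$$ be the ping-pong table, and let $U=\Gamma\cdot D_0=\bigcup_{g\in\Gamma}g(D_0)\subset Sk$. For real numbers $u,v$ define $\gcd(u,v)$ as follows: $\gcd(0,v)=|v|$; if $u\ne0$ and $v/u$ is rational with denominator $n>0$ in lowest terms, then $\gcd(u,v)=|u|/n$; if $u\neq0$ and $v/u$ is irrational, then $\gcd(u,v)=0$. Then for every $x\in\mathcal C(X_1^2)\cup\mathcal C(X_2^2)\cup\mathcal C(X_3^2)$, $$x\in U\iff\gcd(x_1-x_3,\,x_2-x_3)<\tfrac12|d|.$$ Moreover, the complement of $U$ in $Sk$ is $$Sk\setminus U=\bigcup_{(p,q)}\mathbb R_{\ge1}\cdot\tfrac d2\cdot\{(q,p,p+q),\,(p+q,q,p),\,(p,p+q,q)\},$$ where $(p,q)$ runs through all pairs of coprime nonnegative integers and $\mathbb R_{\ge1}\cdot\tfrac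 d2\cdot S=\{t\,\tfrac d2\,v : t\ge1,\ v\in S\}$. -/

import Mathlib

noncomputable section

namespace MarkovSkeleton

/-! Points of `ℝ³` are functions `x : Fin 3 → ℝ`; the paper's coordinates `x₁, x₂, x₃` are
`x 0, x 1, x 2`, and index arithmetic in `Fin 3` is modulo 3.  The parameters `a, b, c` are
collected in `A : Fin 3 → WithTop ℝ` (the value `⊤` is `∞`), and `d : WithTop ℝ`. -/

/-- The tropical monomials of
`X₁X₂X₃ + X₁² + X₂² + X₃² - AX₁ - BX₂ - CX₃ - D`. Entry `0` belongs to `X₁X₂X₃`. -/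
def tropMonomial (A : Fin 3 → WithTop ℝ) (d : WithTop ℝ) (x : Fin 3 → ℝ) :
    Fin 8 → WithTop ℝ :=
  ![((x 0 + x 1 + x 2 : ℝ) : WithTop ℝ),
    ((2 * x 0 : ℝ) : WithTop ℝ), ((2 * x 1 : ℝ) : WithTop ℝ), ((2 * x 2 : ℝ) : WithTop ℝ),
    A 0 + (x 0 : WithTop ℝ), A 1 + (x 1 : WithTop ℝ), A 2 + (x 2 : WithTop ℝ), d]

/-- The tropical polynomial
`f(x) = min(2x₁, 2x₂, 2x₃, x₁ + x₂ + x₃, a + x₁, b + x₂, c + x₃, d)`. -/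
def tropPoly (A : Fin 3 → WithTop ℝ) (d : WithTop ℝ) (x : Fin 3 → ℝ) : WithTop ℝ :=
  Finset.univ.inf (tropMonomial A d x)

/-- The tropical surface: the minimum is attained by at least two tropical monomials. -/
def tropSurface (A : Fin 3 → WithTop ℝ) (d : WithTop ℝ) : Set (Fin 3 → ℝ) :=
  {x | ∃ α β : Fin 8, α ≠ β ∧
    tropMonomial A d x α = tropPoly A d x ∧ tropMonomial A d x β = tropPoly A d x}

/-- The skeleton `Sk(a, b, c, d)`: the points of the tropical surface at which the monomial
`x₁ + x₂ + x₃` attains the minimum. -/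
def skeleton (A : Fin 3 → WithTop ℝ) (d : WithTop ℝ) : Set (Fin 3 → ℝ) :=
  {x ∈ tropSurface A d | ((x 0 + x 1 + x 2 : ℝ) : WithTop ℝ) = tropPoly A d x}

/-- The quadratic cell `C(X_i²)`. -/
def quadraticCell (A : Fin 3 → WithTop ℝ) (d : WithTop ℝ) (i : Fin 3) : Set (Fin 3 → ℝ) :=
  {x ∈ skeleton A d | x 0 + x 1 + x 2 = 2 * x i}

/-- With `{i, j, k} = {1, 2, 3}`: the minimum of `2x_j, 2x_k, a_j + x_j, a_k + x_k, d`. -/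
def vietaMinTop (A : Fin 3 → WithTop ℝ) (d : WithTop ℝ) (i : Fin 3) (x : Fin 3 → ℝ) :
    WithTop ℝ :=
  min ((2 * x (i + 1) : ℝ) : WithTop ℝ) (min ((2 * x (i + 2) : ℝ) : WithTop ℝ)
    (min (A (i + 1) + (x (i + 1) : WithTop ℝ))
      (min (A (i + 2) + (x (i + 2) : WithTop ℝ)) d)))

theorem vietaMinTop_ne_top (A : Fin 3 → WithTop ℝ) (d : WithTop ℝ) (i : Fin 3)
    (x : Fin 3 → ℝ) : vietaMinTop A d i x ≠ ⊤ :=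
  ne_top_of_le_ne_top WithTop.coe_ne_top (min_le_left _ _)

/-- The same minimum, as a real number. -/
def vietaMin (A : Fin 3 → WithTop ℝ) (d : WithTop ℝ) (i : Fin 3) (x : Fin 3 → ℝ) : ℝ :=
  (vietaMinTop A d i x).untop (vietaMinTop_ne_top A d i x)

theorem coe_vietaMin (A : Fin 3 → WithTop ℝ) (d : WithTop ℝ) (i : Fin 3) (x : Fin 3 → ℝ) :
    (vietaMin A d i x : WithTop ℝ) = vietaMinTop A d i x :=
  WithTop.coe_untop _ _

/-- The tropicalized Vieta involution `trop(s_i)` of `ℝ³`: it replaces `x_i` by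
`min(2x_j, 2x_k, a_j + x_j, a_k + x_k, d) - x_i`. -/
def tropVieta (A : Fin 3 → WithTop ℝ) (d : WithTop ℝ) (i : Fin 3) (x : Fin 3 → ℝ) :
    Fin 3 → ℝ :=
  Function.update x i (vietaMin A d i x - x i)

theorem tropVieta_apply (A : Fin 3 → WithTop ℝ) (d : WithTop ℝ) (i : Fin 3) (x : Fin 3 → ℝ) :
    tropVieta A d i x i = vietaMin A d i x - x i ∧
    tropVieta A d i x (i + 1) = x (i + 1) ∧ tropVieta A d i x (i + 2) = x (i + 2) := by
  have h1 : i + 1 ≠ i := by revert i; decide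
  have h2 : i + 2 ≠ i := by revert i; decide
  exact ⟨Function.update_self .., Function.update_of_ne h1 .., Function.update_of_ne h2 ..⟩

theorem vietaMin_tropVieta (A : Fin 3 → WithTop ℝ) (d : WithTop ℝ) (i : Fin 3)
    (x : Fin 3 → ℝ) : vietaMin A d i (tropVieta A d i x) = vietaMin A d i x := by
  obtain ⟨-, h1, h2⟩ := tropVieta_apply A d i x
  simp only [vietaMin, vietaMinTop, h1, h2]

theorem tropVieta_involutive (A : Fin 3 → WithTop ℝ) (d : WithTop ℝ) (i : Fin 3) :
    Function.Involutive (tropVieta A d i) := by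
  intro x
  conv_lhs => rw [tropVieta, vietaMin_tropVieta, (tropVieta_apply A d i x).1]
  simp [tropVieta]

/-- The skeleton is the zero level set of
`min(2x₁, 2x₂, 2x₃, a + x₁, b + x₂, c + x₃, d) - x₁ - x₂ - x₃`. -/
theorem mem_skeleton_iff (A : Fin 3 → WithTop ℝ) (d : WithTop ℝ) (x : Fin 3 → ℝ) :
    x ∈ skeleton A d ↔ ((x 0 + x 1 + x 2 : ℝ) : WithTop ℝ) =
      min ((2 * x 0 : ℝ) : WithTop ℝ) (min ((2 * x 1 : ℝ) : WithTop ℝ)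
        (min ((2 * x 2 : ℝ) : WithTop ℝ) (min (A 0 + (x 0 : WithTop ℝ))
          (min (A 1 + (x 1 : WithTop ℝ)) (min (A 2 + (x 2 : WithTop ℝ)) d))))) := by
  set S : WithTop ℝ := ((x 0 + x 1 + x 2 : ℝ) : WithTop ℝ) with hS
  set M : WithTop ℝ := min ((2 * x 0 : ℝ) : WithTop ℝ) (min ((2 * x 1 : ℝ) : WithTop ℝ)
        (min ((2 * x 2 : ℝ) : WithTop ℝ) (min (A 0 + (x 0 : WithTop ℝ))
          (min (A 1 + (x 1 : WithTop ℝ)) (min (A 2 + (x 2 : WithTop ℝ)) d))))) with hM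
  have hf : tropPoly A d x = min S M := by
    apply le_antisymm
    · have h : ∀ k, tropPoly A d x ≤ tropMonomial A d x k := fun k =>
        Finset.inf_le (Finset.mem_univ k)
      have h0 := h 0
      have h1 := h 1
      have h2 := h 2
      have h3 := h 3
      have h4 := h 4
      have h5 := h 5
      have h6 := h 6
      have h7 := h 7
      simp only [hM, le_min_iff]
      exact ⟨h0, h1, h2, h3, h4, h5, h6, h7⟩
    · refine Finset.le_inf fun k _ => ?_
      have h : min S M ≤ S ∧ min S M ≤ M := ⟨min_le_left _ _, min_le_right _ _⟩
      generalize min S M = N at h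
      simp only [hM, le_min_iff] at h
      obtain ⟨h0, h1, h2, h3, h4, h5, h6, h7⟩ := h
      fin_cases k <;> assumption
  constructor
  · rintro ⟨⟨α, β, hαβ, hα, hβ⟩, hx⟩
    have hx' : S = min S M := hx.trans hf
    obtain ⟨k, hk, hkf⟩ : ∃ k : Fin 8, k ≠ 0 ∧ tropMonomial A d x k = tropPoly A d x := by
      by_cases h : α = 0
      · exact ⟨β, fun hb => hαβ (h.trans hb.symm), hβ⟩
      · exact ⟨α, h, hα⟩
    have hMk : M ≤ tropMonomial A d x k := by
      have h : M ≤ M := le_rfl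
      nth_rewrite 2 [hM] at h
      generalize M = N at h
      simp only [le_min_iff] at h
      obtain ⟨h1, h2, h3, h4, h5, h6, h7⟩ := h
      fin_cases k
      · exact absurd rfl hk
      all_goals assumption
    apply le_antisymm
    · exact hx'.le.trans (min_le_right _ _)
    · exact hMk.trans (hkf.trans hx.symm).le
  · intro h
    have hfS : tropPoly A d x = S := by rw [hf, ← h, min_self]
    have hfM : tropPoly A d x = M := hfS.trans h
    refine ⟨?_, hfS.symm⟩
    obtain ⟨k, hk⟩ : ∃ k : Fin 7, tropMonomial A d x k.succ = M := by
      rcases min_choice ((2 * x 0 : ℝ) : WithTop ℝ) _ with h1 | h1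
      · exact ⟨0, (hM.trans h1).symm⟩
      have e1 := hM.trans h1
      rcases min_choice ((2 * x 1 : ℝ) : WithTop ℝ) _ with h2 | h2
      · exact ⟨1, (e1.trans h2).symm⟩
      have e2 := e1.trans h2
      rcases min_choice ((2 * x 2 : ℝ) : WithTop ℝ) _ with h3 | h3
      · exact ⟨2, (e2.trans h3).symm⟩
      have e3 := e2.trans h3
      rcases min_choice (A 0 + (x 0 : WithTop ℝ)) _ with h4 | h4
      · exact ⟨3, (e3.trans h4).symm⟩
      have e4 := e3.trans h4
      rcases min_choice (A 1 + (x 1 : WithTop ℝ)) _ with h5 | h5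
      · exact ⟨4, (e4.trans h5).symm⟩
      have e5 := e4.trans h5
      rcases min_choice (A 2 + (x 2 : WithTop ℝ)) d with h6 | h6
      · exact ⟨5, (e5.trans h6).symm⟩
      · exact ⟨6, (e5.trans h6).symm⟩
    exact ⟨0, k.succ, (Fin.succ_ne_zero k).symm, hfS.symm, hk.trans hfM.symm⟩

theorem mem_skeleton_iff_vieta (A : Fin 3 → WithTop ℝ) (d : WithTop ℝ) (i : Fin 3)
    (x : Fin 3 → ℝ) :
    x ∈ skeleton A d ↔ ((x i + x (i + 1) + x (i + 2) : ℝ) : WithTop ℝ) =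
      min ((2 * x i : ℝ) : WithTop ℝ) (min (A i + (x i : WithTop ℝ))
        (vietaMin A d i x : WithTop ℝ)) := by
  rw [mem_skeleton_iff, coe_vietaMin, vietaMinTop]
  fin_cases i
  · change _ ↔ ((x 0 + x 1 + x 2 : ℝ) : WithTop ℝ) =
      min ((2 * x 0 : ℝ) : WithTop ℝ) (min (A 0 + (x 0 : WithTop ℝ))
        (min ((2 * x 1 : ℝ) : WithTop ℝ) (min ((2 * x 2 : ℝ) : WithTop ℝ)
          (min (A 1 + (x 1 : WithTop ℝ)) (min (A 2 + (x 2 : WithTop ℝ)) d)))))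
    rw [show x 0 + x 1 + x 2 = x 0 + x 1 + x 2 by ring]
    refine Eq.congr_right ?_
    ac_rfl
  · change _ ↔ ((x 1 + x 2 + x 0 : ℝ) : WithTop ℝ) =
      min ((2 * x 1 : ℝ) : WithTop ℝ) (min (A 1 + (x 1 : WithTop ℝ))
        (min ((2 * x 2 : ℝ) : WithTop ℝ) (min ((2 * x 0 : ℝ) : WithTop ℝ)
          (min (A 2 + (x 2 : WithTop ℝ)) (min (A 0 + (x 0 : WithTop ℝ)) d)))))
    rw [show x 1 + x 2 + x 0 = x 0 + x 1 + x 2 by ring]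
    refine Eq.congr_right ?_
    ac_rfl
  · change _ ↔ ((x 2 + x 0 + x 1 : ℝ) : WithTop ℝ) =
      min ((2 * x 2 : ℝ) : WithTop ℝ) (min (A 2 + (x 2 : WithTop ℝ))
        (min ((2 * x 0 : ℝ) : WithTop ℝ) (min ((2 * x 1 : ℝ) : WithTop ℝ)
          (min (A 0 + (x 0 : WithTop ℝ)) (min (A 1 + (x 1 : WithTop ℝ)) d)))))
    rw [show x 2 + x 0 + x 1 = x 0 + x 1 + x 2 by ring]
    refine Eq.congr_right ?_
    ac_rfl

/-- The skeleton is invariant under the tropicalized Vieta involutions. -/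
theorem tropVieta_mem_skeleton (A : Fin 3 → WithTop ℝ) (d : WithTop ℝ) (i : Fin 3)
    {x : Fin 3 → ℝ} (hx : x ∈ skeleton A d) : tropVieta A d i x ∈ skeleton A d := by
  rw [mem_skeleton_iff_vieta A d i] at hx ⊢
  obtain ⟨h0, h1, h2⟩ := tropVieta_apply A d i x
  rw [vietaMin_tropVieta, h0, h1, h2]
  generalize vietaMin A d i x = F at *
  cases hA : A i with
  | top =>
    rw [hA] at hx
    simp only [WithTop.top_add, min_eq_right le_top] at hx ⊢
    norm_cast at hx ⊢
    rcases le_total (2 * x i) F with h | h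
    · rw [min_eq_left h] at hx
      rw [min_eq_right (by linarith)]; linarith
    · rw [min_eq_right h] at hx
      rw [min_eq_left (by linarith)]; linarith
  | coe a =>
    rw [hA] at hx
    norm_cast at hx ⊢
    have hl := hx.le
    simp only [le_min_iff] at hl
    obtain ⟨l1, l2, l3⟩ := hl
    apply le_antisymm
    · simp only [le_min_iff]
      refine ⟨?_, ?_, ?_⟩ <;> linarith
    · have hg := hx.ge
      simp only [min_le_iff] at hg ⊢
      rcases hg with h | h | h
      · right; right; linarith
      · right; left; linarith
      · left; linarith

/-- `trop(s_i)` as a permutation of the skeleton. -/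
def vietaPerm (A : Fin 3 → WithTop ℝ) (d : WithTop ℝ) (i : Fin 3) :
    Equiv.Perm (skeleton A d) :=
  Function.Involutive.toPerm
    (fun x => ⟨tropVieta A d i x.1, tropVieta_mem_skeleton A d i x.2⟩)
    (fun x => Subtype.ext (tropVieta_involutive A d i x.1))

/-- The group `Γ = ⟨s₁, s₂, s₃⟩`, acting on the skeleton. -/
def vietaGroup (A : Fin 3 → WithTop ℝ) (d : WithTop ℝ) :
    Subgroup (Equiv.Perm (skeleton A d)) :=
  Subgroup.closure (Set.range (vietaPerm A d))

/-- The open half-space `D_i` of the skeleton: the side of the fixed set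
`2x_i = min(2x_j, 2x_k, a_j + x_j, a_k + x_k, d)` of `trop(s_i)` that contains the interior of
`C(X_i²)`, where `2x_i = x₁ + x₂ + x₃` is strictly below that minimum. The involution
`trop(s_i)` interchanges this side with the opposite one, where `2x_i` is strictly above. -/
def halfSpace (A : Fin 3 → WithTop ℝ) (d : WithTop ℝ) (i : Fin 3) : Set (skeleton A d) :=
  {x | 2 * x.1 i < vietaMin A d i x.1}

/-- The ping-pong net `L_i = ∂X_i ∖ ⋃_{j ≠ i} closure X_j`. -/
def pingPongNet {X : Type*} [TopologicalSpace X] (D : Fin 3 → Set X) (i : Fin 3) : Set X :=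
  frontier (D i) \ ⋃ (j : Fin 3) (_ : j ≠ i), closure (D j)

/-- The ping-pong table `X₀ = (X ∖ ⋃ closure X_i) ∪ ⋃ L_i`. -/
def pingPongTable {X : Type*} [TopologicalSpace X] (D : Fin 3 → Set X) : Set X :=
  (⋃ i, closure (D i))ᶜ ∪ ⋃ i, pingPongNet D i

/-- The set `U = Γ.D₀`, the orbit of the ping-pong table. -/
def tableOrbit (A : Fin 3 → WithTop ℝ) (d : WithTop ℝ) : Set (skeleton A d) :=
  ⋃ g ∈ vietaGroup A d, g '' pingPongTable (halfSpace A d)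

open Classical in
/-- Thomae's function: `1/q` at a rational number of reduced denominator `q > 0`, and `0` at an
irrational number. -/
def thomae (x : ℝ) : ℝ :=
  if h : ∃ r : ℚ, (r : ℝ) = x then 1 / (h.choose.den : ℝ) else 0

theorem thomae_ratCast (r : ℚ) : thomae (r : ℝ) = 1 / (r.den : ℝ) := by
  have h : ∃ s : ℚ, (s : ℝ) = (r : ℝ) := ⟨r, rfl⟩
  have hs : h.choose = r := Rat.cast_injective h.choose_spec
  rw [thomae, dif_pos h, hs]

theorem thomae_irrational {x : ℝ} (hx : Irrational x) : thomae x = 0 :=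
  dif_neg fun ⟨r, hr⟩ => hx ⟨r, hr⟩

open Classical in
/-- The greatest common divisor of two real numbers. -/
def realGcd (x y : ℝ) : ℝ :=
  if x = 0 then |y| else |x| * thomae (y / x)

end MarkovSkeleton

end

namespace MarkovSkeleton

/-! Since `d ≤ 2a, 2b, 2c`, the linear terms never lower the minimum. The skeleton becomes `x₁ + x₂
+ x₃ = 2 min(x₁, x₂, x₃, d/2)`, and `s_i` becomes `x_i ↦ 2 min(x_j, x_k, d/2) - x_i`. It consists of
a triangle, whose edges are `x_i = d/2`, and three cells on which the smallest coordinate is `x_i =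
x_j + x_k ≤ d/2`. The ping-pong table is the triangle without its vertices.

On the cell of `i`, with both parts at most `d/2` and `x_j ≤ x_k`, the involution `s_i` replaces
`x_i` by `x_j - x_k`, and `x_j` becomes the new sum: this is the subtractive Euclidean algorithm on
the pair of parts. Run until it enters the triangle, it either reaches the table or stops at a point
with a zero coordinate. In the second case the coordinates of the original point are integral
multiples of one `t ≤ d/2` (`mem_union_latticePoints`).

The two outcomes exclude each other. The set of such lattice points is invariant under `Γ`
(`mem_latticePoints_of_mem_vietaGroup`) and misses the table
(`notMem_latticePoints_of_mem_pingPongTable`), so it is exactly the complement of `U`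
(`compl_tableOrbit`). Both claims then describe lattice points: on a quadratic cell by the gcd of
coordinate differences, and globally by dividing out the gcd of the two integer parts. -/

/-! ### The skeleton and the involutions without the linear terms -/

/-- From `a ≥ d/2 ≥ r/2` and `u ≥ r/2`: a linear term is never below a minimum already bounded by
`2u` and `d`. -/
theorem coe_le_add_of_le_two_nsmul {a : WithTop ℝ} {d r u : ℝ} (ha : (d : WithTop ℝ) ≤ 2 • a)
    (hu : r ≤ 2 * u) (hr : r ≤ d) : (r : WithTop ℝ) ≤ a + (u : WithTop ℝ) := by
  cases a with
  | top => simp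
  | coe a =>
    rw [two_nsmul] at ha
    norm_cast at ha ⊢
    linarith

theorem mem_skeleton_iff_min {A : Fin 3 → WithTop ℝ} {d : ℝ}
    (hA : ∀ i, (d : WithTop ℝ) ≤ 2 • A i) (x : Fin 3 → ℝ) :
    x ∈ skeleton A d ↔
      x 0 + x 1 + x 2 = 2 * min (x 0) (min (x 1) (min (x 2) (d / 2))) := by
  rw [mem_skeleton_iff]
  suffices H : min ((2 * x 0 : ℝ) : WithTop ℝ) (min ((2 * x 1 : ℝ) : WithTop ℝ)
      (min ((2 * x 2 : ℝ) : WithTop ℝ) (min (A 0 + (x 0 : WithTop ℝ))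
        (min (A 1 + (x 1 : WithTop ℝ)) (min (A 2 + (x 2 : WithTop ℝ)) d))))) =
      ((2 * min (x 0) (min (x 1) (min (x 2) (d / 2))) : ℝ) : WithTop ℝ) by
    rw [H, WithTop.coe_inj]
  set r := min (x 0) (min (x 1) (min (x 2) (d / 2))) with hr
  have hle : r ≤ r := le_rfl
  nth_rewrite 2 [hr] at hle
  simp only [le_min_iff] at hle
  obtain ⟨h0, h1, h2, h3⟩ := hle
  apply le_antisymm
  · have hge : r ≤ r := le_rfl
    nth_rewrite 1 [hr] at hge
    simp only [min_le_iff] at hge ⊢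
    simp only [WithTop.coe_le_coe]
    rcases hge with h | h | h | h
    · left; linarith
    · right; left; linarith
    · right; right; left; linarith
    · right; right; right; right; right; right; linarith
  · simp only [le_min_iff, WithTop.coe_le_coe]
    exact ⟨by linarith, by linarith, by linarith,
      coe_le_add_of_le_two_nsmul (hA 0) (by linarith) (by linarith),
      coe_le_add_of_le_two_nsmul (hA 1) (by linarith) (by linarith),
      coe_le_add_of_le_two_nsmul (hA 2) (by linarith) (by linarith), by linarith⟩

theorem vietaMin_eq_min {A : Fin 3 → WithTop ℝ} {d : ℝ}
    (hA : ∀ i, (d : WithTop ℝ) ≤ 2 • A i) (i : Fin 3) (x : Fin 3 → ℝ) :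
    vietaMin A d i x = 2 * min (x (i + 1)) (min (x (i + 2)) (d / 2)) := by
  rw [← WithTop.coe_inj, coe_vietaMin, vietaMinTop]
  set r := min (x (i + 1)) (min (x (i + 2)) (d / 2)) with hr
  have hle : r ≤ r := le_rfl
  nth_rewrite 2 [hr] at hle
  simp only [le_min_iff] at hle
  obtain ⟨h1, h2, h3⟩ := hle
  apply le_antisymm
  · have hge : r ≤ r := le_rfl
    nth_rewrite 1 [hr] at hge
    simp only [min_le_iff] at hge ⊢
    simp only [WithTop.coe_le_coe]
    rcases hge with h | h | h
    · left; linarith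
    · right; left; linarith
    · right; right; right; right; linarith
  · simp only [le_min_iff, WithTop.coe_le_coe]
    exact ⟨by linarith, by linarith,
      coe_le_add_of_le_two_nsmul (hA _) (by linarith) (by linarith),
      coe_le_add_of_le_two_nsmul (hA _) (by linarith) (by linarith), by linarith⟩

/-- The indices `i, j, k` are `0, 1, 2` in some order. -/
def IsTriple (i j k : Fin 3) : Prop := i ≠ j ∧ i ≠ k ∧ j ≠ k

theorem IsTriple.eq_add {i j k : Fin 3} (h : IsTriple i j k) :
    (j = i + 1 ∧ k = i + 2) ∨ (j = i + 2 ∧ k = i + 1) := by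
  unfold IsTriple at h
  revert i j k; decide

theorem IsTriple.eq_or {i j k : Fin 3} (h : IsTriple i j k) (l : Fin 3) :
    l = i ∨ l = j ∨ l = k := by
  unfold IsTriple at h
  revert i j k l; decide

theorem isTriple_add (i : Fin 3) : IsTriple i (i + 1) (i + 2) := by
  unfold IsTriple
  revert i; decide

theorem IsTriple.swap_right {i j k : Fin 3} (h : IsTriple i j k) : IsTriple i k j :=
  ⟨h.2.1, h.1, h.2.2.symm⟩

theorem IsTriple.swap_left {i j k : Fin 3} (h : IsTriple i j k) : IsTriple j i k :=
  ⟨h.1.symm, h.2.2, h.2.1⟩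

theorem IsTriple.mem_skeleton_iff {A : Fin 3 → WithTop ℝ} {d : ℝ}
    (hA : ∀ i, (d : WithTop ℝ) ≤ 2 • A i) {i j k : Fin 3} (h : IsTriple i j k) (x : Fin 3 → ℝ) :
    x ∈ skeleton A d ↔
      x i + x j + x k = 2 * min (x i) (min (x j) (min (x k) (d / 2))) := by
  rw [mem_skeleton_iff_min hA]
  have key : ∀ σ : Fin 3 → Fin 3, IsTriple (σ 0) (σ 1) (σ 2) →
      (x 0 + x 1 + x 2 = x (σ 0) + x (σ 1) + x (σ 2) ∧
      min (x 0) (min (x 1) (min (x 2) (d / 2))) =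
        min (x (σ 0)) (min (x (σ 1)) (min (x (σ 2)) (d / 2)))) := by
    intro σ hσ
    generalize σ 0 = i at *
    generalize σ 1 = j at *
    generalize σ 2 = k at *
    obtain ⟨h1, h2, h3⟩ := hσ
    fin_cases i <;> fin_cases j <;> fin_cases k <;>
      first
      | exact absurd rfl h1
      | exact absurd rfl h2
      | exact absurd rfl h3
      | refine ⟨by simp only [Fin.zero_eta, Fin.mk_one, Fin.reduceFinMk] <;> ring, ?_⟩
        apply le_antisymm <;> simp
  obtain ⟨h1, h2⟩ := key ![i, j, k] h
  rw [h1, h2]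
  rfl

theorem IsTriple.vietaMin_eq {A : Fin 3 → WithTop ℝ} {d : ℝ}
    (hA : ∀ i, (d : WithTop ℝ) ≤ 2 • A i) {i j k : Fin 3} (h : IsTriple i j k) (x : Fin 3 → ℝ) :
    vietaMin A d i x = 2 * min (x j) (min (x k) (d / 2)) := by
  rw [vietaMin_eq_min hA]
  rcases h.eq_add with ⟨rfl, rfl⟩ | ⟨rfl, rfl⟩
  · rfl
  · rw [min_left_comm]

/-- The sum is at most `x_j + x_k`, because twice a minimum is at most the sum of any two of its
entries. -/
theorem skeleton_nonpos {A : Fin 3 → WithTop ℝ} {d : ℝ} (hA : ∀ i, (d : WithTop ℝ) ≤ 2 • A i)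
    {x : Fin 3 → ℝ} (hx : x ∈ skeleton A d) (i : Fin 3) : x i ≤ 0 := by
  rw [(isTriple_add i).mem_skeleton_iff hA] at hx
  have h1 : min (x i) (min (x (i + 1)) (min (x (i + 2)) (d / 2))) ≤ x (i + 1) := by simp
  have h2 : min (x i) (min (x (i + 1)) (min (x (i + 2)) (d / 2))) ≤ x (i + 2) := by simp
  linarith

theorem IsTriple.mem_skeleton_of_add {A : Fin 3 → WithTop ℝ} {d : ℝ}
    (hA : ∀ i, (d : WithTop ℝ) ≤ 2 • A i) {i j k : Fin 3} (h : IsTriple i j k) {x : Fin 3 → ℝ}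
    (hx : x i = x j + x k) (hj : x j ≤ 0) (hk : x k ≤ 0) (hi : x i ≤ d / 2) :
    x ∈ skeleton A d := by
  rw [h.mem_skeleton_iff hA, min_eq_left (by simp only [le_min_iff]; refine ⟨?_, ?_, ?_⟩ <;> linarith)]
  linarith

theorem IsTriple.eq_add_of_le {A : Fin 3 → WithTop ℝ} {d : ℝ}
    (hA : ∀ i, (d : WithTop ℝ) ≤ 2 • A i) {i j k : Fin 3} (h : IsTriple i j k) {x : Fin 3 → ℝ}
    (hx : x ∈ skeleton A d) (hj : x i ≤ x j) (hk : x i ≤ x k) (hi : x i ≤ d / 2) :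
    x i = x j + x k := by
  rw [h.mem_skeleton_iff hA, min_eq_left (by simp only [le_min_iff]; exact ⟨hj, hk, hi⟩)] at hx
  linarith

/-! ### Half-spaces, their closures and the ping-pong table -/

theorem mem_halfSpace_iff {A : Fin 3 → WithTop ℝ} {d : ℝ} (hA : ∀ i, (d : WithTop ℝ) ≤ 2 • A i)
    {i j k : Fin 3} (h : IsTriple i j k) (x : skeleton A d) :
    x ∈ halfSpace A d i ↔ x.1 i < x.1 j ∧ x.1 i < x.1 k ∧ x.1 i < d / 2 := by
  change 2 * x.1 i < vietaMin A d i x.1 ↔ _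
  rw [h.vietaMin_eq hA, mul_lt_mul_iff_right₀ two_pos]
  simp only [lt_min_iff]

theorem isOpen_halfSpace {A : Fin 3 → WithTop ℝ} {d : ℝ} (hA : ∀ i, (d : WithTop ℝ) ≤ 2 • A i)
    (i : Fin 3) : IsOpen (halfSpace A d i) := by
  have : halfSpace A d i = {x | x.1 i < x.1 (i + 1)} ∩ ({x | x.1 i < x.1 (i + 2)} ∩
      {x | x.1 i < d / 2}) := Set.ext fun x => mem_halfSpace_iff hA (isTriple_add i) x
  rw [this]
  have hc : ∀ l, Continuous fun y : skeleton A d => y.1 l := fun l =>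
    (continuous_apply l).comp continuous_subtype_val
  exact (isOpen_lt (hc _) (hc _)).inter
    ((isOpen_lt (hc _) (hc _)).inter (isOpen_lt (hc _) continuous_const))

/-- The weak inequalities force `x_i = x_j + x_k`, and a point of this plane can be pushed inside it
into the open half-space. -/
theorem mem_closure_halfSpace_iff {A : Fin 3 → WithTop ℝ} {d : ℝ}
    (hA : ∀ i, (d : WithTop ℝ) ≤ 2 • A i)
    {i j k : Fin 3} (h : IsTriple i j k) (x : skeleton A d) :
    x ∈ closure (halfSpace A d i) ↔ x.1 i ≤ x.1 j ∧ x.1 i ≤ x.1 k ∧ x.1 i ≤ d / 2 := by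
  constructor
  · have hc : IsClosed {y : skeleton A d | y.1 i ≤ y.1 j ∧ y.1 i ≤ y.1 k ∧ y.1 i ≤ d / 2} := by
      have hc : ∀ l, Continuous fun y : skeleton A d => y.1 l := fun l =>
        (continuous_apply l).comp continuous_subtype_val
      exact (isClosed_le (hc _) (hc _)).inter
        ((isClosed_le (hc _) (hc _)).inter (isClosed_le (hc _) continuous_const))
    refine fun hx => hc.closure_subset_iff.2 (fun y hy => ?_) hx
    obtain ⟨h1, h2, h3⟩ := (mem_halfSpace_iff hA h y).1 hy
    exact ⟨h1.le, h2.le, h3.le⟩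
  · rintro ⟨hj, hk, hi⟩
    have he := h.eq_add_of_le hA x.2 hj hk hi
    have nj := skeleton_nonpos hA x.2 j
    have nk := skeleton_nonpos hA x.2 k
    rw [Metric.mem_closure_iff]
    intro ε hε
    set δ : ℝ := ε / 3
    have hδ : 0 < δ := by positivity
    -- The direction `(-2, -1, -1)` preserves `x_i = x_j + x_k` and makes all three inequalities
    -- strict.
    set y : Fin 3 → ℝ := fun l => if l = i then x.1 l - 2 * δ else x.1 l - δ with hy
    have yi : y i = x.1 i - 2 * δ := by simp [hy]
    have yj : y j = x.1 j - δ := by simp [hy, h.1.symm]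
    have yk : y k = x.1 k - δ := by simp [hy, h.2.1.symm]
    have hs : y ∈ skeleton A d := by
      refine h.mem_skeleton_of_add hA ?_ ?_ ?_ ?_ <;> simp only [yi, yj, yk] <;> linarith
    refine ⟨⟨y, hs⟩, (mem_halfSpace_iff hA h _).2 ?_, ?_⟩
    · simp only [yi, yj, yk]
      refine ⟨?_, ?_, ?_⟩ <;> linarith
    · rw [Subtype.dist_eq, dist_pi_lt_iff hε]
      intro l
      rw [Real.dist_eq, abs_lt]
      have e3 : ε = 3 * δ := by simp only [δ]; ring
      rcases h.eq_or l with rfl | rfl | rfl <;> simp only [yi, yj, yk] <;>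
        constructor <;> linarith

/-- The ping-pong table is the triangle cell without its vertices. -/
theorem mem_pingPongTable_iff {A : Fin 3 → WithTop ℝ} {d : ℝ}
    (hA : ∀ i, (d : WithTop ℝ) ≤ 2 • A i) (x : skeleton A d) :
    x ∈ pingPongTable (halfSpace A d) ↔ ∀ i, d / 2 ≤ x.1 i ∧ x.1 i < 0 := by
  have hsum : ∀ {i j k : Fin 3}, IsTriple i j k → x.1 i + x.1 j + x.1 k =
      2 * min (x.1 i) (min (x.1 j) (min (x.1 k) (d / 2))) := fun h =>
    (h.mem_skeleton_iff hA x.1).1 x.2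
  have hcl := fun i => mem_closure_halfSpace_iff hA (isTriple_add i) x
  constructor
  · rintro (hx | hx)
    · simp only [Set.mem_compl_iff, Set.mem_iUnion, not_exists] at hx
      -- If some coordinate were at most `d/2`, the smallest one, `x_m`, would put the point in the
      -- closure of `D_m`.
      have hgt : ∀ i, d / 2 < x.1 i := by
        by_contra! hc
        obtain ⟨m, hm⟩ := Finite.exists_min x.1
        obtain ⟨i, hi⟩ := hc
        exact hx m ((hcl m).2 ⟨hm _, hm _, (hm i).trans hi⟩)
      intro i
      have hs := hsum (isTriple_add i)
      have h1 := min_le_right (x.1 i) (min (x.1 (i + 1)) (min (x.1 (i + 2)) (d / 2)))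
      have h2 := min_le_right (x.1 (i + 1)) (min (x.1 (i + 2)) (d / 2))
      have h3 := min_le_right (x.1 (i + 2)) (d / 2)
      have h4 := hgt (i + 1)
      have h5 := hgt (i + 2)
      exact ⟨(hgt i).le, by linarith⟩
    · simp only [Set.mem_iUnion, pingPongNet, Set.mem_sdiff, not_exists,
        (isOpen_halfSpace hA _).frontier_eq] at hx
      obtain ⟨i, ⟨hi, hni⟩, hj⟩ := hx
      -- A tie `x_i = x_j` would put the point in the closure of `D_j`; hence on the net the only
      -- inequality that can fail to be strict is `x_i ≤ d/2`.
      have lt_of : ∀ {j k}, IsTriple i j k → x.1 i < x.1 j := by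
        intro j k h
        obtain ⟨h1, h2, h3⟩ := (mem_closure_halfSpace_iff hA h x).1 hi
        refine lt_of_le_of_ne h1 fun he => hj j h.1.symm ?_
        rw [mem_closure_halfSpace_iff hA h.swap_left, ← he]
        exact ⟨le_rfl, h2, h3⟩
      have h1 := lt_of (isTriple_add i)
      have h2 := lt_of (isTriple_add i).swap_right
      have hie : x.1 i = d / 2 := by
        refine le_antisymm ((hcl i).1 hi).2.2 (le_of_not_gt fun h3 => hni ?_)
        exact (mem_halfSpace_iff hA (isTriple_add i) x).2 ⟨h1, h2, h3⟩
      have hadd := (isTriple_add i).eq_add_of_le hA x.2 h1.le h2.le hie.le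
      intro l
      rcases (isTriple_add i).eq_or l with rfl | rfl | rfl <;> constructor <;> linarith
  · intro hx
    -- Points on an edge of the triangle lie in a net; the other points avoid all the closures.
    by_cases hi : ∃ i, x.1 i = d / 2
    · right
      obtain ⟨i, hi⟩ := hi
      have hadd := (isTriple_add i).eq_add_of_le hA x.2 (by linarith [hx (i + 1)])
        (by linarith [hx (i + 2)]) hi.le
      simp only [Set.mem_iUnion, pingPongNet, Set.mem_sdiff, not_exists,
        (isOpen_halfSpace hA _).frontier_eq]
      refine ⟨i, ⟨(hcl i).2 ⟨?_, ?_, hi.le⟩, fun h => ?_⟩, fun j hj h => ?_⟩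
      · linarith [hx (i + 1)]
      · linarith [hx (i + 2)]
      · exact ((mem_halfSpace_iff hA (isTriple_add i) x).1 h).2.2.ne hi
      · have hle := ((hcl j).1 h).2.2
        have h1 := hx (i + 1)
        have h2 := hx (i + 2)
        rcases (isTriple_add i).eq_or j with rfl | rfl | rfl
        · exact hj rfl
        · linarith
        · linarith
    · left
      simp only [Set.mem_compl_iff, Set.mem_iUnion, not_exists]
      exact fun i h => hi ⟨i, le_antisymm ((hcl i).1 h).2.2 (hx i).1⟩


/-! ### Lattice points: invariance under the group, disjointness from the table -/

/-- The points of the skeleton all of whose coordinates are integral multiples of some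
`t ≤ d / 2`. -/
def latticePoints (A : Fin 3 → WithTop ℝ) (d : ℝ) : Set (skeleton A d) :=
  {x | ∃ t ≤ d / 2, ∃ n : Fin 3 → ℤ, ∀ i, x.1 i = t * n i}

theorem IsTriple.mem_latticePoints {A : Fin 3 → WithTop ℝ} {d : ℝ} {i j k : Fin 3}
    (h : IsTriple i j k) (x : skeleton A d) {t : ℝ} (ht : t ≤ d / 2) (l m n : ℤ)
    (hi : x.1 i = t * l) (hj : x.1 j = t * m) (hk : x.1 k = t * n) : x ∈ latticePoints A d := by
  refine ⟨t, ht, fun r => if r = i then l else if r = j then m else n, fun r => ?_⟩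
  rcases h.eq_or r with rfl | rfl | rfl
  · simpa using hi
  · simpa [h.1.symm] using hj
  · simpa [h.2.1.symm, h.2.2.symm] using hk

theorem IsTriple.vietaPerm_apply {A : Fin 3 → WithTop ℝ} {d : ℝ}
    (hA : ∀ i, (d : WithTop ℝ) ≤ 2 • A i) {i j k : Fin 3} (h : IsTriple i j k)
    (x : skeleton A d) :
    (vietaPerm A d i x).1 i = 2 * min (x.1 j) (min (x.1 k) (d / 2)) - x.1 i ∧
      (vietaPerm A d i x).1 j = x.1 j ∧ (vietaPerm A d i x).1 k = x.1 k := by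
  rw [← h.vietaMin_eq hA]
  exact ⟨Function.update_self .., Function.update_of_ne h.1.symm ..,
    Function.update_of_ne h.2.1.symm ..⟩

/-- On lattice points the minimum in `s_i` is always attained by `x_j` or `x_k`, so `s_i` acts
through an integral formula and the same `t` serves for the image. -/
theorem vietaPerm_mem_latticePoints {A : Fin 3 → WithTop ℝ} {d : ℝ} (hd : d < 0)
    (hA : ∀ i, (d : WithTop ℝ) ≤ 2 • A i) (i : Fin 3) {x : skeleton A d}
    (hx : x ∈ latticePoints A d) : vietaPerm A d i x ∈ latticePoints A d := by
  obtain ⟨t, ht, n, hn⟩ := hx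
  have h := isTriple_add i
  have hs := (h.mem_skeleton_iff hA x.1).1 x.2
  obtain ⟨hi, hj, hk⟩ := h.vietaPerm_apply hA x
  generalize i + 1 = j at *
  generalize i + 2 = k at *
  -- As `t ≤ d/2 < 0`, the only multiple of `t` in `(d/2, 0]` is `0`.
  have zero_of : ∀ l, d / 2 < x.1 l → x.1 l = 0 := by
    intro l hl
    have h0 := skeleton_nonpos hA x.2 l
    rw [hn l] at hl h0 ⊢
    have h1 : (n l : ℝ) < 1 := by nlinarith
    have h2 : (0 : ℝ) ≤ n l := by nlinarith
    have h3 : n l = 0 := by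
      have h1' : n l < 1 := by exact_mod_cast h1
      have h2' : 0 ≤ n l := by exact_mod_cast h2
      omega
    simp [h3]
  have hmin : min (x.1 j) (min (x.1 k) (d / 2)) = x.1 j ∨
      min (x.1 j) (min (x.1 k) (d / 2)) = x.1 k := by
    rcases min_choice (x.1 j) (min (x.1 k) (d / 2)) with h1 | h1
    · exact .inl h1
    rcases min_choice (x.1 k) (d / 2) with h2 | h2
    · exact .inr (h1.trans h2)
    -- If `d/2` were strictly smallest, then `x_j = x_k = 0`, and the skeleton equation `x_i = 2
    -- min(x_i, d/2)` would have no lattice solution.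
    by_contra! hne
    have e : min (x.1 j) (min (x.1 k) (d / 2)) = d / 2 := h1.trans h2
    rw [e] at hne
    have hj0 := zero_of j (lt_of_le_of_ne (e ▸ min_le_left _ _) hne.1)
    have hk0 := zero_of k (lt_of_le_of_ne (h2 ▸ min_le_left _ _) hne.2)
    rw [hj0, hk0] at hs
    rw [hj0, hk0] at e
    rw [e] at hs
    rcases le_or_gt (x.1 i) (d / 2) with h3 | h3
    · rw [min_eq_left h3] at hs; linarith
    · rw [min_eq_right h3.le, zero_of i h3] at hs; linarith
  rcases hmin with hm | hm <;> rw [hm] at hi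
  · refine h.mem_latticePoints _ ht (2 * n j - n i) (n j) (n k) ?_ (hj.trans (hn j))
      (hk.trans (hn k))
    rw [hi, hn j, hn i]; push_cast; ring
  · refine h.mem_latticePoints _ ht (2 * n k - n i) (n j) (n k) ?_ (hj.trans (hn j))
      (hk.trans (hn k))
    rw [hi, hn k, hn i]; push_cast; ring

theorem mem_latticePoints_of_mem_vietaGroup {A : Fin 3 → WithTop ℝ} {d : ℝ} (hd : d < 0)
    (hA : ∀ i, (d : WithTop ℝ) ≤ 2 • A i) {g : Equiv.Perm (skeleton A d)}
    (hg : g ∈ vietaGroup A d) (x : skeleton A d) :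
    g x ∈ latticePoints A d ↔ x ∈ latticePoints A d := by
  induction hg using Subgroup.closure_induction generalizing x with
  | mem g hg =>
    obtain ⟨i, rfl⟩ := hg
    refine ⟨fun h => ?_, vietaPerm_mem_latticePoints hd hA i⟩
    have := vietaPerm_mem_latticePoints hd hA i h
    rwa [show vietaPerm A d i (vietaPerm A d i x) = x from
      Subtype.ext (tropVieta_involutive A d i x.1)] at this
  | one => rfl
  | mul g g' _ _ h h' => rw [Equiv.Perm.mul_apply, h, h']
  | inv g _ h => rw [← h, show g (g⁻¹ x) = x from g.apply_symm_apply x]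

/-- Negative lattice coordinates are at most `d/2`, while those of the table are at least `d/2`. All
three would equal `d/2`, against `x_i = x_j + x_k`. -/
theorem notMem_latticePoints_of_mem_pingPongTable {A : Fin 3 → WithTop ℝ} {d : ℝ} (hd : d < 0)
    (hA : ∀ i, (d : WithTop ℝ) ≤ 2 • A i) {x : skeleton A d}
    (hx : x ∈ pingPongTable (halfSpace A d)) : x ∉ latticePoints A d := by
  rintro ⟨t, ht, n, hn⟩
  rw [mem_pingPongTable_iff hA] at hx
  have hle : ∀ i, x.1 i ≤ d / 2 := by
    intro i
    have h0 := (hx i).2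
    rw [hn i] at h0 ⊢
    have h1 : (0 : ℝ) < n i := by nlinarith
    have h2 : (1 : ℝ) ≤ n i := by
      have : 0 < n i := by exact_mod_cast h1
      exact_mod_cast this
    nlinarith
  have h := (isTriple_add 0).eq_add_of_le hA x.2 (by linarith [hle 0, hx (0 + 1)])
    (by linarith [hle 0, hx (0 + 2)]) (hle 0)
  linarith [hx 0, hle (0 + 1), hle (0 + 2)]

/-! ### The orbit of the table and the Euclidean algorithm -/

theorem mem_tableOrbit_iff {A : Fin 3 → WithTop ℝ} {d : WithTop ℝ} (x : skeleton A d) :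
    x ∈ tableOrbit A d ↔ ∃ g ∈ vietaGroup A d, g x ∈ pingPongTable (halfSpace A d) := by
  simp only [tableOrbit, Set.mem_iUnion, Set.mem_image, exists_prop]
  constructor
  · rintro ⟨g, hg, y, hy, rfl⟩
    exact ⟨g⁻¹, inv_mem hg, by rwa [show g⁻¹ (g y) = y from g.symm_apply_apply y]⟩
  · rintro ⟨g, hg, hx⟩
    exact ⟨g⁻¹, inv_mem hg, g x, hx, g.symm_apply_apply x⟩

theorem pingPongTable_subset_tableOrbit (A : Fin 3 → WithTop ℝ) (d : WithTop ℝ) :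
    pingPongTable (halfSpace A d) ⊆ tableOrbit A d := fun x hx =>
  (mem_tableOrbit_iff x).2 ⟨1, one_mem _, hx⟩

theorem mem_tableOrbit_of_vietaPerm {A : Fin 3 → WithTop ℝ} {d : WithTop ℝ} (i : Fin 3)
    {x : skeleton A d} (hx : vietaPerm A d i x ∈ tableOrbit A d) : x ∈ tableOrbit A d := by
  obtain ⟨g, hg, h⟩ := (mem_tableOrbit_iff _).1 hx
  exact (mem_tableOrbit_iff _).2
    ⟨g * vietaPerm A d i, mul_mem hg (Subgroup.subset_closure ⟨i, rfl⟩), h⟩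

theorem mem_union_of_vietaPerm {A : Fin 3 → WithTop ℝ} {d : ℝ} (hd : d < 0)
    (hA : ∀ i, (d : WithTop ℝ) ≤ 2 • A i) (i : Fin 3) {x : skeleton A d}
    (hx : vietaPerm A d i x ∈ tableOrbit A d ∪ latticePoints A d) :
    x ∈ tableOrbit A d ∪ latticePoints A d :=
  hx.imp (mem_tableOrbit_of_vietaPerm i)
    (mem_latticePoints_of_mem_vietaGroup hd hA (Subgroup.subset_closure ⟨i, rfl⟩) x).1

/-- The Euclidean algorithm once the smaller of the two parts is at most `|d| / 2`. -/
theorem mem_union_of_small_part {A : Fin 3 → WithTop ℝ} {d : ℝ} (hd : d < 0)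
    (hA : ∀ i, (d : WithTop ℝ) ≤ 2 • A i) (n : ℕ) {i j k : Fin 3} (h : IsTriple i j k)
    (x : skeleton A d) (hi : x.1 i = x.1 j + x.1 k) (hk : d / 2 ≤ x.1 k) (hk0 : x.1 k < 0)
    (hj : n * x.1 k ≤ x.1 j) (hj0 : x.1 j < 0) :
    x ∈ tableOrbit A d ∪ latticePoints A d := by
  induction n generalizing i j k x with
  | zero => simp at hj; linarith
  | succ n ih =>
    have table : ∀ y : skeleton A d, (d / 2 ≤ y.1 i ∧ y.1 i < 0) → (d / 2 ≤ y.1 j ∧ y.1 j < 0) →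
        (d / 2 ≤ y.1 k ∧ y.1 k < 0) → y ∈ tableOrbit A d ∪ latticePoints A d := by
      refine fun y h1 h2 h3 => .inl (pingPongTable_subset_tableOrbit _ _
        ((mem_pingPongTable_iff hA y).2 fun l => ?_))
      rcases h.eq_or l with rfl | rfl | rfl <;> assumption
    rcases le_or_gt (d / 2) (x.1 i) with hie | hie
    · exact table x ⟨hie, by linarith⟩ ⟨by linarith, hj0⟩ ⟨hk, hk0⟩
    apply mem_union_of_vietaPerm hd hA i
    obtain ⟨vi, vj, vk⟩ := h.vietaPerm_apply hA x
    generalize vietaPerm A d i x = y at *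
    rcases le_or_gt (d / 2) (x.1 j) with hje | hje
    · rw [min_eq_right hk, min_eq_right hje] at vi
      rcases eq_or_ne (y.1 i) 0 with h0 | h0
      · refine .inr (h.mem_latticePoints y (t := d / 2) le_rfl 0 1 1 ?_ ?_ ?_) <;> push_cast <;>
          linarith
      · have hle : y.1 i ≤ 0 := by linarith
        exact table y ⟨by linarith, lt_of_le_of_ne hle h0⟩ ⟨by linarith, by linarith⟩
          ⟨by linarith, by linarith⟩
    · rw [min_eq_right hk, min_eq_left hje.le] at vi
      push_cast at hj
      -- Now `x_j` is the sum of `y_i = x_j - x_k` and the unchanged small part `x_k`; one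
      -- subtraction uses up one unit of `n`.
      refine ih h.swap_left y ?_ ?_ ?_ ?_ ?_ <;> (try rw [vk]) <;> linarith

/-- The Euclidean algorithm on the interior of a quadratic cell. -/
theorem mem_union_of_add {A : Fin 3 → WithTop ℝ} {d : ℝ} (hd : d < 0)
    (hA : ∀ i, (d : WithTop ℝ) ≤ 2 • A i) (n : ℕ) {i j k : Fin 3} (h : IsTriple i j k)
    (x : skeleton A d) (hi : x.1 i = x.1 j + x.1 k) (hj0 : x.1 j < 0) (hk0 : x.1 k < 0)
    (hn : n * (d / 2) ≤ x.1 i) :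
    x ∈ tableOrbit A d ∪ latticePoints A d := by
  induction n generalizing i j k x with
  | zero => simp at hn; linarith
  | succ n ih =>
    wlog hjk : x.1 j ≤ x.1 k generalizing j k
    · exact this h.swap_right (by linarith) hk0 hj0 (by linarith)
    rcases le_or_gt (d / 2) (x.1 k) with hk | hk
    · obtain ⟨m, hm⟩ := exists_nat_ge (x.1 j / x.1 k)
      exact mem_union_of_small_part hd hA m h x hi hk hk0 ((div_le_iff_of_neg hk0).1 hm) hj0
    apply mem_union_of_vietaPerm hd hA i
    obtain ⟨vi, vj, vk⟩ := h.vietaPerm_apply hA x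
    generalize vietaPerm A d i x = y at *
    rw [min_eq_left hk.le, min_eq_left hjk] at vi
    push_cast at hn
    rcases eq_or_ne (y.1 i) 0 with h0 | h0
    · refine .inr (h.mem_latticePoints y hk.le 0 1 1 ?_ ?_ ?_) <;> push_cast <;> linarith
    · refine ih h.swap_left y (by linarith) (lt_of_le_of_ne (by linarith) h0) (by linarith) ?_
      linarith

theorem mem_pingPongTable_of_lt {A : Fin 3 → WithTop ℝ} {d : ℝ}
    (hA : ∀ i, (d : WithTop ℝ) ≤ 2 • A i) {x : skeleton A d} (hx : ∀ i, d / 2 < x.1 i) :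
    x ∈ pingPongTable (halfSpace A d) := by
  refine (mem_pingPongTable_iff hA x).2 fun l => ?_
  have hs := ((isTriple_add l).mem_skeleton_iff hA x.1).1 x.2
  have h1 := hx l
  have h2 := hx (l + 1)
  have h3 := hx (l + 2)
  rw [min_eq_right h3.le, min_eq_right h2.le, min_eq_right h1.le] at hs
  exact ⟨h1.le, by linarith⟩

/-- If the smallest coordinate exceeds `d/2`, the point is in the table. Otherwise it is the sum of
the other two: a zero part gives a lattice point with `t = x_i`, and two negative parts start the
Euclidean algorithm. -/
theorem mem_union_latticePoints {A : Fin 3 → WithTop ℝ} {d : ℝ} (hd : d < 0)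
    (hA : ∀ i, (d : WithTop ℝ) ≤ 2 • A i) (x : skeleton A d) :
    x ∈ tableOrbit A d ∪ latticePoints A d := by
  obtain ⟨i, hi⟩ := Finite.exists_min x.1
  have h := isTriple_add i
  rcases le_or_gt (x.1 i) (d / 2) with hie | hie
  · have hadd := h.eq_add_of_le hA x.2 (hi _) (hi _) hie
    generalize i + 1 = j at *
    generalize i + 2 = k at *
    have hj := skeleton_nonpos hA x.2 j
    have hk := skeleton_nonpos hA x.2 k
    rcases hj.eq_or_lt with hj | hj
    · refine .inr (h.mem_latticePoints x hie 1 0 1 ?_ ?_ ?_) <;> push_cast <;> linarith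
    rcases hk.eq_or_lt with hk | hk
    · refine .inr (h.mem_latticePoints x hie 1 1 0 ?_ ?_ ?_) <;> push_cast <;> linarith
    obtain ⟨m, hm⟩ := exists_nat_ge (x.1 i / (d / 2))
    exact mem_union_of_add hd hA m h x hadd hj hk ((div_le_iff_of_neg (by linarith)).1 hm)
  · exact .inl (pingPongTable_subset_tableOrbit _ _
      (mem_pingPongTable_of_lt hA fun l => hie.trans_le (hi l)))

theorem compl_tableOrbit {A : Fin 3 → WithTop ℝ} {d : ℝ} (hd : d < 0)
    (hA : ∀ i, (d : WithTop ℝ) ≤ 2 • A i) : (tableOrbit A d)ᶜ = latticePoints A d := by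
  ext x
  refine ⟨fun hx => (mem_union_latticePoints hd hA x).resolve_left hx, fun hx hU => ?_⟩
  obtain ⟨g, hg, h⟩ := (mem_tableOrbit_iff x).1 hU
  exact notMem_latticePoints_of_mem_pingPongTable hd hA h
    ((mem_latticePoints_of_mem_vietaGroup hd hA hg x).2 hx)


/-! ### The real gcd and quadratic cells -/

/-- Commensurable reals, not both zero, have a greatest common measure, and any other common measure
is no larger in absolute value. Positivity of `c` excludes the value `0` given to incommensurable
pairs and to `(0, 0)`. -/
theorem le_realGcd_iff {c : ℝ} (hc : 0 < c) (u v : ℝ) :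
    c ≤ realGcd u v ↔
      ∃ t : ℝ, c ≤ |t| ∧ ∃ m n : ℤ, (u ≠ 0 ∨ v ≠ 0) ∧ u = t * m ∧ v = t * n := by
  rw [realGcd]
  constructor
  · intro h
    split_ifs at h with hu
    · refine ⟨v, h, 0, 1, .inr ?_, by simp [hu], by simp⟩
      rintro rfl
      simp at h; linarith
    · by_cases hr : Irrational (v / u)
      · rw [thomae_irrational hr] at h; linarith
      · simp only [Irrational, Set.mem_range, not_not] at hr
        obtain ⟨r, hr⟩ := hr
        have hden : (r.den : ℝ) ≠ 0 := by exact_mod_cast r.den_nz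
        rw [← hr, thomae_ratCast] at h
        refine ⟨u / r.den, ?_, r.den, r.num, .inl hu, ?_, ?_⟩
        · rwa [abs_div, Nat.abs_cast, div_eq_mul_one_div]
        · push_cast; field_simp
        · have h2 : v = u * r := by rw [hr]; field_simp
          rw [h2]
          nth_rewrite 1 [← Rat.num_div_den r]
          push_cast; ring
  · rintro ⟨t, ht, m, n, h0, rfl, rfl⟩
    have t0 : t ≠ 0 := by
      rintro rfl
      simp at ht; linarith
    split_ifs with hu
    · have hn : n ≠ 0 := by
        rintro rfl
        simp [hu] at h0
      have : (1 : ℝ) ≤ |(n : ℝ)| := by exact_mod_cast Int.one_le_abs hn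
      rw [abs_mul]
      nlinarith [abs_nonneg t]
    · have hm : m ≠ 0 := by
        rintro rfl
        simp at hu
      have hr : t * n / (t * m) = (((n : ℚ) / m : ℚ) : ℝ) := by
        push_cast
        exact mul_div_mul_left _ _ t0
      rw [hr, thomae_ratCast, abs_mul]
      -- The reduced denominator is at most `|m|`, so dividing `|t| |m|` by it leaves at least
      -- `|t|`.
      have hdvd : (((n : ℚ) / m : ℚ).den : ℤ) ∣ m := by
        rw [← Rat.divInt_eq_div]
        exact Rat.den_dvd n m
      have hle : ((((n : ℚ) / m : ℚ).den : ℤ) : ℝ) ≤ |(m : ℝ)| := by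
        exact_mod_cast Int.le_of_dvd (abs_pos.2 hm) ((dvd_abs _ _).2 hdvd)
      have hpos : (0 : ℝ) < (((n : ℚ) / m : ℚ).den : ℝ) := by exact_mod_cast Rat.den_pos _
      push_cast at hle
      rw [mul_one_div, le_div_iff₀ hpos]
      nlinarith [abs_nonneg t]

/-- The cell equation `x_i = x_j + x_k` recovers all three coordinates as integral combinations of
the two differences, so coordinates and differences have the same common measures. -/
theorem mem_latticePoints_iff_le_realGcd {A : Fin 3 → WithTop ℝ} {d : ℝ} (hd : d < 0)
    (hA : ∀ i, (d : WithTop ℝ) ≤ 2 • A i) (x : skeleton A d) {i : Fin 3}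
    (hx : x.1 0 + x.1 1 + x.1 2 = 2 * x.1 i) :
    x ∈ latticePoints A d ↔
      1 / 2 * |d| ≤ realGcd (x.1 0 - x.1 2) (x.1 1 - x.1 2) := by
  have hd2 : 1 / 2 * |d| = -(d / 2) := by rw [abs_of_neg hd]; ring
  rw [hd2, le_realGcd_iff (by linarith)]
  have n0 := skeleton_nonpos hA x.2 0
  have n1 := skeleton_nonpos hA x.2 1
  have n2 := skeleton_nonpos hA x.2 2
  have hsk := (mem_skeleton_iff_min hA x.1).1 x.2
  have hle : min (x.1 0) (min (x.1 1) (min (x.1 2) (d / 2))) ≤ d / 2 := by simp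
  constructor
  · rintro ⟨t, ht, n, hn⟩
    refine ⟨t, by rw [abs_of_neg (by linarith)]; linarith, n 0 - n 2, n 1 - n 2, ?_, ?_, ?_⟩
    -- Equal coordinates in a quadratic cell would all vanish, but the coordinate sum is at most `d
    -- < 0`.
    · by_contra! hc
      fin_cases i <;> simp only [Fin.zero_eta, Fin.mk_one, Fin.reduceFinMk] at hx <;> linarith
    · rw [hn 0, hn 2]; push_cast; ring
    · rw [hn 1, hn 2]; push_cast; ring
  · rintro ⟨t, ht, m, n, -, hm, hn⟩
    have lattice : ∀ {t : ℝ} {m n : ℤ}, t ≤ d / 2 → x.1 0 - x.1 2 = t * m →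
        x.1 1 - x.1 2 = t * n → x ∈ latticePoints A d := by
      intro t m n ht hm hn
      have h012 : IsTriple 0 1 2 := by unfold IsTriple; decide
      fin_cases i <;> simp only [Fin.zero_eta, Fin.mk_one, Fin.reduceFinMk] at hx
      · refine h012.mem_latticePoints x ht (2 * m - n) m (m - n) ?_ ?_ ?_ <;> push_cast <;> linarith
      · refine h012.mem_latticePoints x ht n (2 * n - m) (n - m) ?_ ?_ ?_ <;> push_cast <;> linarith
      · refine h012.mem_latticePoints x ht (-n) (-m) (-m - n) ?_ ?_ ?_ <;> push_cast <;> linarith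
    -- A lattice generator must be negative, so a positive common measure is replaced by its
    -- opposite.
    rcases le_abs'.1 ht with h | h
    · exact lattice (by linarith) hm hn
    · exact lattice (t := -t) (m := -m) (n := -n) (by linarith) (by push_cast; linarith)
        (by push_cast; linarith)

/-! ### Lattice points as rays through coprime pairs -/

theorem image_latticePoints {A : Fin 3 → WithTop ℝ} {d : ℝ} (hd : d < 0)
    (hA : ∀ i, (d : WithTop ℝ) ≤ 2 • A i) :
    Subtype.val '' latticePoints A d =
      ⋃ (p : ℕ) (q : ℕ) (_ : Nat.Coprime p q),
        {y : Fin 3 → ℝ | ∃ t : ℝ, 1 ≤ t ∧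
          ∃ v ∈ ({![(q : ℝ), (p : ℝ), (p : ℝ) + q], ![(p : ℝ) + q, (q : ℝ), (p : ℝ)],
              ![(p : ℝ), (p : ℝ) + q, (q : ℝ)]} : Set (Fin 3 → ℝ)),
            y = (t * (d / 2)) • v} := by
  ext y
  simp only [Set.mem_image, Set.mem_iUnion, Set.mem_ofPred_eq, exists_prop]
  constructor
  · rintro ⟨x, ⟨s, hs, n, hn⟩, rfl⟩
    have key : ∀ i j k, IsTriple i j k → x.1 i = x.1 j + x.1 k → ∃ p q : ℕ, p.Coprime q ∧
        ∃ t : ℝ, 1 ≤ t ∧ x.1 j = t * (d / 2) * p ∧ x.1 k = t * (d / 2) * q := by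
      intro i j k h hi
      have nat_of : ∀ l, ∃ m : ℕ, n l = m := by
        intro l
        have h0 := skeleton_nonpos hA x.2 l
        rw [hn l] at h0
        have h1 : (0 : ℝ) ≤ n l := by nlinarith
        exact Int.eq_ofNat_of_zero_le (by exact_mod_cast h1)
      obtain ⟨a, ha⟩ := nat_of j
      obtain ⟨b, hb⟩ := nat_of k
      have hxj : x.1 j = s * a := by rw [hn j, ha]; norm_cast
      have hxk : x.1 k = s * b := by rw [hn k, hb]; norm_cast
      -- Two zero parts would make the coordinate sum zero, which the skeleton equation forbids.
      have hg : 0 < a.gcd b := by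
        rw [Nat.pos_iff_ne_zero, Ne, Nat.gcd_eq_zero_iff]
        rintro ⟨rfl, rfl⟩
        have hsk := (h.mem_skeleton_iff hA x.1).1 x.2
        have hle : min (x.1 i) (min (x.1 j) (min (x.1 k) (d / 2))) ≤ d / 2 := by simp
        simp at hxj hxk
        linarith
      obtain ⟨p, q, hpq, hp, hq⟩ := Nat.exists_coprime a b
      have hg1 : (1 : ℝ) ≤ a.gcd b := by exact_mod_cast hg
      -- The gcd of the two multiples is absorbed into the scale; `s ≤ d/2 < 0` and gcd at least `1`
      -- give `t ≥ 1`.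
      refine ⟨p, q, hpq, s * a.gcd b / (d / 2), ?_, ?_, ?_⟩
      · rw [le_div_iff_of_neg (by linarith)]
        nlinarith
      · rw [hxj, div_mul_cancel₀ _ (by linarith)]
        nth_rewrite 1 [hp]
        push_cast; ring
      · rw [hxk, div_mul_cancel₀ _ (by linarith)]
        nth_rewrite 1 [hq]
        push_cast; ring
    obtain ⟨i, hi⟩ := Finite.exists_min x.1
    have hie : x.1 i ≤ d / 2 := by
      by_contra! hc
      exact notMem_latticePoints_of_mem_pingPongTable hd hA
        (mem_pingPongTable_of_lt hA fun l => hc.trans_le (hi l)) ⟨s, hs, n, hn⟩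
    have hadd := (isTriple_add i).eq_add_of_le hA x.2 (hi _) (hi _) hie
    obtain ⟨p, q, hpq, t, ht, hj, hk⟩ :=
      -- The swap assigns `q` to index `i + 1` and `p` to index `i + 2`, the cyclic order of the
      -- three listed vectors.
      key _ _ _ (isTriple_add i).swap_right (hadd.trans (add_comm _ _))
    refine ⟨p, q, hpq, t, ht, ?_⟩
    rw [hj, hk] at hadd
    fin_cases i
    · refine ⟨![(p : ℝ) + q, q, p], by simp, ?_⟩
      ext l
      fin_cases l
      · simpa [mul_add, add_comm] using hadd
      · simpa using hk
      · simpa using hj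
    · refine ⟨![(p : ℝ), (p : ℝ) + q, q], by simp, ?_⟩
      ext l
      fin_cases l
      · simpa using hj
      · simpa [mul_add, add_comm] using hadd
      · simpa using hk
    · refine ⟨![(q : ℝ), p, (p : ℝ) + q], by simp, ?_⟩
      ext l
      fin_cases l
      · simpa using hk
      · simpa using hj
      · simpa [mul_add, add_comm] using hadd
  · rintro ⟨p, q, hpq, t, ht, v, hv, rfl⟩
    have key : ∀ i j k, IsTriple i j k → v i = v j + v k → v j = p → v k = q →
        ∃ x ∈ latticePoints A d, x.1 = (t * (d / 2)) • v := by
      intro i j k h hi hj hk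
      have hpq1 : (1 : ℝ) ≤ (p : ℝ) + q := by
        have : p + q ≠ 0 := by
          intro h0
          obtain ⟨rfl, rfl⟩ : p = 0 ∧ q = 0 := by omega
          simp at hpq
        exact_mod_cast Nat.one_le_iff_ne_zero.2 this
      have htd : t * (d / 2) ≤ d / 2 := by nlinarith
      have hp0 : (0 : ℝ) ≤ p := p.cast_nonneg
      have hq0 : (0 : ℝ) ≤ q := q.cast_nonneg
      refine ⟨⟨(t * (d / 2)) • v, h.mem_skeleton_of_add hA ?_ ?_ ?_ ?_⟩,
        h.mem_latticePoints _ htd (p + q) p q ?_ ?_ ?_, rfl⟩ <;>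
        simp only [Pi.smul_apply, smul_eq_mul, hi, hj, hk] <;> push_cast
      · ring
      · nlinarith
      · nlinarith
      · nlinarith
      · ring
      · rfl
      · rfl
    simp only [Set.mem_insert_iff, Set.mem_singleton_iff] at hv
    rcases hv with rfl | rfl | rfl
    · obtain ⟨x, hx, h⟩ := key 2 1 0 (by unfold IsTriple; decide) (by simp) (by simp) (by simp)
      exact ⟨x, hx, h⟩
    · obtain ⟨x, hx, h⟩ := key 0 2 1 (by unfold IsTriple; decide) (by simp) (by simp) (by simp)
      exact ⟨x, hx, h⟩
    · obtain ⟨x, hx, h⟩ := key 1 0 2 (by unfold IsTriple; decide) (by simp) (by simp) (by simp)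
      exact ⟨x, hx, h⟩

end MarkovSkeleton

theorem mainTheorem5 (a b c : WithTop ℝ) (d : ℝ) (hd : d < 0)
    (h : (d : WithTop ℝ) ≤ min (2 • a) (min (2 • b) (2 • c))) :
    (∀ x : MarkovSkeleton.skeleton ![a, b, c] (d : WithTop ℝ),
      (x : Fin 3 → ℝ) ∈ ⋃ i : Fin 3, MarkovSkeleton.quadraticCell ![a, b, c] (d : WithTop ℝ) i →
      (x ∈ MarkovSkeleton.tableOrbit ![a, b, c] (d : WithTop ℝ) ↔
        MarkovSkeleton.realGcd (x.1 0 - x.1 2) (x.1 1 - x.1 2) < 1 / 2 * |d|)) ∧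
    Subtype.val '' (MarkovSkeleton.tableOrbit ![a, b, c] (d : WithTop ℝ))ᶜ =
      ⋃ (p : ℕ) (q : ℕ) (_ : Nat.Coprime p q),
        {y : Fin 3 → ℝ | ∃ t : ℝ, 1 ≤ t ∧
          ∃ v ∈ ({![(q : ℝ), (p : ℝ), (p : ℝ) + q], ![(p : ℝ) + q, (q : ℝ), (p : ℝ)],
              ![(p : ℝ), (p : ℝ) + q, (q : ℝ)]} : Set (Fin 3 → ℝ)),
            y = (t * (d / 2)) • v} := by
  have hA : ∀ i, (d : WithTop ℝ) ≤ 2 • (![a, b, c] : Fin 3 → WithTop ℝ) i := by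
    simp only [le_min_iff] at h
    intro i
    fin_cases i
    exacts [h.1, h.2.1, h.2.2]
  refine ⟨fun x hx => ?_, ?_⟩
  · obtain ⟨i, -, hi⟩ := Set.mem_iUnion.1 hx
    rw [← not_iff_not, not_lt, ← MarkovSkeleton.mem_latticePoints_iff_le_realGcd hd hA x hi,
      ← MarkovSkeleton.compl_tableOrbit hd hA, Set.mem_compl_iff]
  · rw [MarkovSkeleton.compl_tableOrbit hd hA, MarkovSkeleton.image_latticePoints hd hA]
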